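/- Let $V$ be a non-empty finite set of points in the Euclidean plane and let $0<\theta<\pi/3$. Let $\mathcal{DT}(V)$ be a Delaunay triangulation of $V$, i.e. a maximal plane straight-line graph with vertex set $V$ such that for every edge $uv$ some circle through $u$ and $v$ has no point of $V$ strictly inside (no general position is assumed; if there are several, take any one). Put $\kappa=\lceil 2\pi/\theta\rceil$ and, for every $u\in V$, fix any partition of the plane minus $u$ into $\kappa$ cones with apex $u$, each of angle measure at most $\theta$. For a cone $C$ at $u$ let $v_0,\dots,v_m$ be the neighbours of $u$ in $\mathcal{DT}(V)$ that lie in $C$, in angular order around $u$. The edges $uv_0$ and $uv_m$ are called extreme at $u$; those of $uv_1,uv_{m-1}$ that are not extreme (these exist only if $m\ge 2$) are called penultimate at $u$; and if $m\ge 4$, a shortest one among the other edges $uv_2,\dots,uv_{m-2}$ (one edge per cone, ties broken arbitrarily) is called the middle edge at $u$. An edge is protected at $u$ if it is extreme, penultimate or middle at $u$ with respect to some cone at $u$. Let $\mathcal{MBDG}(V)$ be the graph on $V$ whose edges are the edges $uv$ of $\mathcal{DT}(V)$ that are protected both at $u$ and at $v$. (The marks that are additionally stored at the vertices of this graph do not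 affect its edges.) Then $\mathcal{MBDG}(V)$ contains a minimum spanning tree of $V$: there is a spanning tree $T$ of the complete graph on $V$ with minimum total Euclidean edge length such that every edge of $T$ is an edge of $\mathcal{MBDG}(V)$. -/

import Mathlib

open Real

/-! Points of the Euclidean plane are complex numbers; a geometric graph on a finite point set `V`
is a `SimpleGraph V`, each edge being drawn as the straight segment between its endpoints. -/

/-- A straight-line graph is plane: no edge passes through a third vertex, and two distinct edges
meet at most in common endpoints. -/
def IsPlane {V : Finset ℂ} (G : SimpleGraph V) : Prop :=
  (∀ a b w : V, G.Adj a b → (w : ℂ) ∈ segment ℝ (a : ℂ) (b : ℂ) → w = a ∨ w = b) ∧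
  (∀ a b c d : V, G.Adj a b → G.Adj c d → s(a, b) ≠ s(c, d) →
    segment ℝ (a : ℂ) (b : ℂ) ∩ segment ℝ (c : ℂ) (d : ℂ) ⊆
      {(a : ℂ), (b : ℂ)} ∩ {(c : ℂ), (d : ℂ)})

/-- Some circle passes through `u` and `v` and has no point of `V` strictly inside. -/
def HasEmptyCircle {V : Finset ℂ} (u v : V) : Prop :=
  ∃ c : ℂ, dist c u = dist c v ∧ ∀ w : V, dist c u ≤ dist c w

/-- A Delaunay triangulation of `V`: a triangulation of `V` (a maximal plane straight-line graph
with vertex set `V`) all of whose edges have the empty circle property. No general position is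
assumed, so `V` may have several Delaunay triangulations (and if `V` is collinear, the only one
is the path along the line). -/
structure IsDelaunayTriangulation {V : Finset ℂ} (G : SimpleGraph V) : Prop where
  maximal_plane : Maximal IsPlane G
  empty_circle : ∀ u v : V, G.Adj u v → HasEmptyCircle u v

/-- The number `κ = ⌈2π/θ⌉` of cones at each point. -/
noncomputable def coneCount (θ : ℝ) : ℕ := ⌈2 * π / θ⌉₊

/-- `z` lies on the open ray from `u` in the direction of (counterclockwise) angle `t`. -/
def OnRay (u : ℂ) (t : ℝ) (z : ℂ) : Prop :=
  ∃ r : ℝ, 0 < r ∧ z = u + r * Complex.exp (t * Complex.I)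

/-- The cone with apex `u` swept by the rays whose angles lie in `A`. -/
def sector (u : ℂ) (A : Set ℝ) : Set ℂ := {z | ∃ t ∈ A, OnRay u t z}

/-- A partition of the plane (minus the apex `u`) into `κ` cones with apex `u`, each of angle
measure at most `θ`. It is open to the partition which cone contains a bounding ray. -/
structure ConePartition (θ : ℝ) (u : ℂ) where
  arc : Fin (coneCount θ) → Set ℝ
  ordConnected : ∀ i, (arc i).OrdConnected
  width_le : ∀ i, ∀ s ∈ arc i, ∀ t ∈ arc i, t - s ≤ θ
  partition : ∀ z : ℂ, z ≠ u → ∃! i, z ∈ sector u (arc i)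

/-- In the cone with apex `u` and angle interval `A`, the point `v` does not come after `w` in
angular order. -/
def AngleLE (u : ℂ) (A : Set ℝ) (v w : ℂ) : Prop :=
  ∃ s ∈ A, ∃ t ∈ A, OnRay u s v ∧ OnRay u t w ∧ s ≤ t

/-- The first and the last element of `S` in the angular order around `u`. -/
def angularEnds {V : Finset ℂ} (u : V) (A : Set ℝ) (S : Set V) : Set V :=
  {v | v ∈ S ∧ ((∀ w ∈ S, AngleLE u A v w) ∨ (∀ w ∈ S, AngleLE u A w v))}

section MBDG

variable {V : Finset ℂ} {θ : ℝ} (DT : SimpleGraph V) (C : (u : V) → ConePartition θ (u : ℂ))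

/-- The Delaunay neighbours `v₀, …, vₘ` of `u` in its `i`-th cone. -/
def coneNeighbors (u : V) (i : Fin (coneCount θ)) : Set V :=
  {v | DT.Adj u v ∧ (v : ℂ) ∈ sector (u : ℂ) ((C u).arc i)}

/-- The `v` for which `uv` is extreme at `u` (induced by the `i`-th cone): `v₀` and `vₘ`. -/
def extremeAt (u : V) (i : Fin (coneCount θ)) : Set V :=
  angularEnds u ((C u).arc i) (coneNeighbors DT C u i)

/-- The `v` for which `uv` is penultimate at `u`: those of `v₁`, `vₘ₋₁` that are not extreme, that
is, the first and the last of the non-extreme neighbours. -/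
def penultimateAt (u : V) (i : Fin (coneCount θ)) : Set V :=
  angularEnds u ((C u).arc i) (coneNeighbors DT C u i \ extremeAt DT C u i)

/-- The neighbours of `u` in the cone that are neither extreme nor penultimate; there are any
exactly if the cone has at least five neighbours, that is, exactly if two distinct extreme and two
distinct penultimate edges leave an edge over. -/
def remainingAt (u : V) (i : Fin (coneCount θ)) : Set V :=
  (coneNeighbors DT C u i \ extremeAt DT C u i) \ penultimateAt DT C u i

/-- `mid` selects in each cone a shortest one of the remaining edges, if there is any; ties are
broken arbitrarily. -/
def IsMiddleChoice (mid : V → Fin (coneCount θ) → V) : Prop :=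
  ∀ u i, (remainingAt DT C u i).Nonempty →
    mid u i ∈ remainingAt DT C u i ∧
      ∀ w ∈ remainingAt DT C u i, dist (u : ℂ) (mid u i : ℂ) ≤ dist (u : ℂ) (w : ℂ)

/-- `uv` is protected at `u`: it is extreme, penultimate or middle at `u`. -/
def ProtectedAt (mid : V → Fin (coneCount θ) → V) (u v : V) : Prop :=
  ∃ i, v ∈ extremeAt DT C u i ∨ v ∈ penultimateAt DT C u i ∨
    (v ∈ remainingAt DT C u i ∧ v = mid u i)

/-- The (marked) bounded degree graph: its edges are the fully protected Delaunay edges. The marks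
are information stored at the vertices and do not affect the graph. -/
def MBDG (mid : V → Fin (coneCount θ) → V) : SimpleGraph V where
  Adj u v := DT.Adj u v ∧ ProtectedAt DT C mid u v ∧ ProtectedAt DT C mid v u
  symm := ⟨fun _ _ h => ⟨h.1.symm, h.2.2, h.2.1⟩⟩
  loopless := ⟨fun _ h => DT.irrefl h.1⟩

end MBDG

/-- The Euclidean length of an edge. -/
noncomputable def edgeLength {V : Finset ℂ} : Sym2 V → ℝ :=
  Sym2.lift ⟨fun a b => dist (a : ℂ) (b : ℂ), fun _ _ => dist_comm _ _⟩

open Classical in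
/-- The weight of a geometric graph: the total length of its edges. -/
noncomputable def weight {V : Finset ℂ} (G : SimpleGraph V) : ℝ :=
  ∑ e ∈ G.edgeFinset, edgeLength e

/-- A (Euclidean) minimum spanning tree of `V`. -/
def IsMinimumSpanningTree {V : Finset ℂ} (T : SimpleGraph V) : Prop :=
  T.IsTree ∧ ∀ T' : SimpleGraph V, T'.IsTree → weight T ≤ weight T'

/-! Among all minimum spanning trees take one, `T`, with the fewest edges outside the bounded degree
graph. It lies in `DT`, by `IsMinimumSpanningTree.le_of_isDelaunayTriangulation`. Suppose an edge
`uv` of `T` is not protected at `u`, and let `uw` be the middle edge of its cone. Then `uw` is no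
longer than `uv`, and the angle below `π / 3` makes `vw` shorter than `uv`. So `uw` can replace
`uv`: the alternative replacement `vw` would lower the weight (`IsMinimumSpanningTree.exchange`).
The new edge is not extreme at `u`, hence it is extreme at `w`
(`IsMinimumSpanningTree.mem_extremeAt_or`) and so fully protected. The new tree has fewer bad edges,
a contradiction.

If a tree edge `uw` were extreme at neither end, there would be, on one side of it, neighbours `y`
of `u` and `x` of `w` in the respective cones. As `uw` is shortest in both cones, `uy` and `wx` are
long enough to cross (`exists_crossing`), against planarity. -/

/-! ### Edge exchange in trees. -/

namespace SimpleGraph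

variable {W : Type*} {T : SimpleGraph W} {u v a b : W}

/-- Deleting the edge `uv` leaves every vertex connected to `u` or to `v`. -/
theorem Reachable.deleteEdge_or {x : W} (h : T.Reachable u x) (v : W) :
    (T.deleteEdges {s(u, v)}).Reachable u x ∨ (T.deleteEdges {s(u, v)}).Reachable v x := by
  obtain ⟨p⟩ := h.symm
  clear h
  induction p with
  | nil => exact Or.inl .rfl
  | @cons y z u hyz p ih =>
    by_cases he : s(y, z) = s(u, v)
    · rcases Sym2.eq_iff.1 he with ⟨rfl, rfl⟩ | ⟨rfl, rfl⟩
      · exact Or.inl .rfl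
      · exact Or.inr .rfl
    · have hzy : (T.deleteEdges {s(u, v)}).Reachable z y :=
        (Adj.reachable (by rw [deleteEdges_adj]; exact ⟨hyz, he⟩)).symm
      exact ih.imp (·.trans hzy) (·.trans hzy)

/-- Edge exchange in a tree. -/
theorem IsTree.exchange (hT : T.IsTree) (huv : T.Adj u v)
    (ha : (T.deleteEdges {s(u, v)}).Reachable u a)
    (hb : (T.deleteEdges {s(u, v)}).Reachable v b) :
    (T.deleteEdges {s(u, v)} ⊔ edge a b).IsTree := by
  have hbr : ¬ (T.deleteEdges {s(u, v)}).Reachable u v :=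
    isBridge_iff.1 (isAcyclic_iff_forall_adj_isBridge.1 hT.isAcyclic huv)
  have hab : ¬ (T.deleteEdges {s(u, v)}).Reachable a b := fun h =>
    hbr ((ha.trans h).trans hb.symm)
  have hne : a ≠ b := fun h => hab (h ▸ .rfl)
  have hacy : (T.deleteEdges {s(u, v)} ⊔ edge a b).IsAcyclic :=
    (hT.isAcyclic.anti (deleteEdges_le _)).sup_edge_of_not_reachable hab
  have hle : T.deleteEdges {s(u, v)} ≤ T.deleteEdges {s(u, v)} ⊔ edge a b := le_sup_left
  have hadj : (T.deleteEdges {s(u, v)} ⊔ edge a b).Reachable a b :=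
    Adj.reachable (Or.inr ((edge_adj ..).2 ⟨Or.inl ⟨rfl, rfl⟩, hne⟩))
  have huv' : (T.deleteEdges {s(u, v)} ⊔ edge a b).Reachable u v :=
    ((ha.mono hle).trans hadj).trans (hb.mono hle).symm
  have hu : ∀ x, (T.deleteEdges {s(u, v)} ⊔ edge a b).Reachable u x := fun x =>
    ((hT.connected.preconnected u x).deleteEdge_or v).elim (·.mono hle)
      fun h => huv'.trans (h.mono hle)
  have : Nonempty W := ⟨u⟩
  exact ⟨⟨fun x y => (hu x).symm.trans (hu y)⟩, hacy⟩

end SimpleGraph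

/-! ### Minimum spanning trees and their exchanges. -/

section MinimumSpanningTree

open SimpleGraph

variable {V : Finset ℂ} {T : SimpleGraph V} {u v w a b : V}

theorem edgeLength_nonneg (e : Sym2 V) : 0 ≤ edgeLength e := by
  induction e with
  | _ x y => exact dist_nonneg (x := (x : ℂ)) (y := (y : ℂ))

/-- Only an inequality, since `ab` may already be one of the edges kept. -/
theorem weight_exchange_le (huv : T.Adj u v) (a b : V) :
    weight (T.deleteEdges {s(u, v)} ⊔ edge a b) ≤
      weight T - dist (u : ℂ) v + dist (a : ℂ) b := by
  classical
  have h1 : (T.deleteEdges {s(u, v)} ⊔ edge a b).edgeFinset ⊆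
      insert s(a, b) (T.edgeFinset.erase s(u, v)) := by
    intro e
    induction e with
    | _ x y =>
      simp only [mem_edgeFinset, mem_edgeSet, sup_adj, deleteEdges_adj, adj_edge,
        Finset.mem_insert, Finset.mem_erase, Set.mem_singleton_iff]
      rintro (⟨h, h'⟩ | ⟨h, -⟩)
      · exact Or.inr ⟨h', h⟩
      · exact Or.inl h.symm
  have h2 : (∑ e ∈ T.edgeFinset.erase s(u, v), edgeLength e) + edgeLength s(u, v) = weight T :=
    Finset.sum_erase_add _ _ (by simpa using huv)
  have h3 : ∑ e ∈ insert s(a, b) (T.edgeFinset.erase s(u, v)), edgeLength e ≤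
      edgeLength s(a, b) + ∑ e ∈ T.edgeFinset.erase s(u, v), edgeLength e := by
    by_cases hm : s(a, b) ∈ T.edgeFinset.erase s(u, v)
    · rw [Finset.insert_eq_of_mem hm]
      linarith [edgeLength_nonneg s(a, b)]
    · rw [Finset.sum_insert hm]
  have h4 : weight (T.deleteEdges {s(u, v)} ⊔ edge a b) ≤ _ :=
    Finset.sum_le_sum_of_subset_of_nonneg (by convert h1) fun e _ _ => edgeLength_nonneg e
  have h5 : edgeLength s(u, v) = dist (u : ℂ) v := rfl
  have h6 : edgeLength s(a, b) = dist (a : ℂ) b := rfl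
  linarith

theorem exists_isMinimumSpanningTree (hV : V.Nonempty) :
    ∃ T : SimpleGraph V, IsMinimumSpanningTree T := by
  have : Nonempty V := hV.to_subtype
  obtain ⟨T₀, -, hT₀⟩ := (connected_top (V := V)).exists_isTree_le
  obtain ⟨T, hT, hmin⟩ := Set.exists_min_image {T : SimpleGraph V | T.IsTree} weight
    (Set.toFinite _) ⟨T₀, hT₀⟩
  exact ⟨T, hT, hmin⟩

/-- In a minimum spanning tree, an edge `uv` can be replaced by `uw` if `vw` is shorter than `uv`
and `uw` is not longer. -/
theorem IsMinimumSpanningTree.exchange (hT : IsMinimumSpanningTree T) (huv : T.Adj u v)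
    (hvw : dist (v : ℂ) w < dist (u : ℂ) v) (huw : dist (u : ℂ) w ≤ dist (u : ℂ) v) :
    IsMinimumSpanningTree (T.deleteEdges {s(u, v)} ⊔ edge u w) ∧
      dist (u : ℂ) w = dist (u : ℂ) v := by
  -- If `w` is on the side of `u`, the shorter edge `wv` reconnects the tree, against minimality.
  -- Otherwise `uw` does, and minimality forces equal lengths.
  rcases (hT.1.connected.preconnected u w).deleteEdge_or v with h | h
  · have h1 := hT.2 _ (hT.1.exchange huv h .rfl)
    have h2 := weight_exchange_le huv w v
    rw [_root_.dist_comm (w : ℂ)] at h2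
    linarith
  · have h0 := hT.1.exchange huv .rfl h
    have h1 := hT.2 _ h0
    have h2 := weight_exchange_le huv u w
    exact ⟨⟨h0, fun T' hT' => by linarith [hT.2 T' hT']⟩, by linarith⟩

/-- The lune of an edge of a minimum spanning tree contains no other point. -/
theorem IsMinimumSpanningTree.le_of_lt (hT : IsMinimumSpanningTree T) (huv : T.Adj u v)
    (hvw : dist (v : ℂ) w < dist (u : ℂ) v) : dist (u : ℂ) v ≤ dist (u : ℂ) w := by
  by_contra! h
  linarith [(hT.exchange huv hvw h.le).2]

end MinimumSpanningTree

/-! ### Rays, narrow triangles and crossing segments. -/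

section Geometry

theorem OnRay.angle_eq {u z : ℂ} {s t : ℝ} (hs : OnRay u s z) (ht : OnRay u t z)
    (hst : |s - t| < π) : s = t := by
  obtain ⟨r, hr, rfl⟩ := hs
  obtain ⟨q, hq, h⟩ := ht
  have hre := congrArg Complex.re (add_left_cancel h)
  have him := congrArg Complex.im (add_left_cancel h)
  simp only [Complex.re_ofReal_mul, Complex.im_ofReal_mul, Complex.exp_ofReal_mul_I_re,
    Complex.exp_ofReal_mul_I_im] at hre him
  -- The cross product of the two representations of `z - u`.
  have hsin : r * q * sin (s - t) = 0 := by
    rw [sin_sub]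
    linear_combination q * cos t * him - q * sin t * hre
  have h0 : sin (s - t) = 0 := (mul_eq_zero.1 hsin).resolve_left (mul_pos hr hq).ne'
  exact sub_eq_zero.1
    ((sin_eq_zero_iff_of_lt_of_lt (abs_lt.1 hst).1 (abs_lt.1 hst).2).1 h0)

/-- Two sides of a triangle that enclose an angle below `π / 3`: the third side is shorter than
the longer of the two. -/
theorem dist_lt_of_onRay {u v w : ℂ} {s t : ℝ} (hv : OnRay u s v) (hw : OnRay u t w)
    (hst : |s - t| < π / 3) (hwv : dist u w ≤ dist u v) : dist v w < dist u v := by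
  obtain ⟨r, hr, rfl⟩ := hv
  obtain ⟨q, hq, rfl⟩ := hw
  have hd : ∀ (p x : ℝ), 0 < p → dist u (u + p * Complex.exp (x * Complex.I)) = p := by
    intro p x hp
    rw [dist_self_add_right, norm_mul, Complex.norm_exp_ofReal_mul_I, Complex.norm_real,
      Real.norm_of_nonneg hp.le, mul_one]
  rw [hd r s hr, hd q t hq] at hwv
  rw [hd r s hr]
  have hcos : 1 / 2 < cos (s - t) := by
    rw [← cos_pi_div_three, ← cos_abs (s - t)]
    exact cos_lt_cos_of_nonneg_of_le_pi (abs_nonneg _) (by linarith [pi_pos]) hst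
  rw [dist_add_left, Complex.dist_eq_re_im, Real.sqrt_lt' hr]
  simp only [Complex.re_ofReal_mul, Complex.im_ofReal_mul, Complex.exp_ofReal_mul_I_re,
    Complex.exp_ofReal_mul_I_im]
  rw [cos_sub] at hcos
  have h1 := mul_lt_mul_of_pos_left hcos (mul_pos hr hq)
  -- Law of cosines; with `1 / 2 < cos (s - t)` the right side is below `r ^ 2 + q * (q - r)`.
  have h2 : (r * cos s - q * cos t) ^ 2 + (r * sin s - q * sin t) ^ 2 =
      r ^ 2 + q ^ 2 - 2 * (r * q * (cos s * cos t + sin s * sin t)) := by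
    linear_combination r ^ 2 * sin_sq_add_cos_sq s + q ^ 2 * sin_sq_add_cos_sq t
  nlinarith [mul_nonneg hq.le (sub_nonneg.2 hwv)]

/-- Two segments of length at least `|uw|` that leave `u` and `w` on the same side of `uw` at
angles below `π / 3` cross. -/
theorem exists_crossing {u w x y : ℂ} {s t α β : ℝ} (hw : OnRay u s w) (hy : OnRay u (s + β) y)
    (hu : OnRay w t u) (hx : OnRay w (t - α) x) (hα : |α| < π / 3) (hβ : |β| < π / 3)
    (hαβ : 0 < α * β) (huy : dist u w ≤ dist u y) (hwx : dist u w ≤ dist w x) :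
    ∃ p ∈ segment ℝ u y ∩ segment ℝ w x, p ≠ u ∧ p ≠ y := by
  obtain ⟨l, hl, hwl⟩ := hw
  obtain ⟨r, hr, rfl⟩ := hy
  obtain ⟨l', hl', hul⟩ := hu
  obtain ⟨q, hq, rfl⟩ := hx
  have hd : ∀ (z : ℂ) (p x : ℝ), 0 < p → dist z (z + p * Complex.exp (x * Complex.I)) = p := by
    intro z p x hp
    rw [dist_self_add_right, norm_mul, Complex.norm_exp_ofReal_mul_I, Complex.norm_real,
      Real.norm_of_nonneg hp.le, mul_one]
  have hdl : dist u w = l := by rw [hwl]; exact hd _ _ _ hl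
  have hdl' : dist u w = l' := by rw [dist_comm, hul]; exact hd _ _ _ hl'
  obtain rfl : l = l' := hdl.symm.trans hdl'
  rw [hd _ _ _ hr, hdl] at huy
  rw [hd _ _ _ hq, hdl] at hwx
  have hlC : (l : ℂ) ≠ 0 := by exact_mod_cast hl.ne'
  have hexp : Complex.exp (t * Complex.I) = -Complex.exp (s * Complex.I) := by
    have : (l : ℂ) * (Complex.exp (t * Complex.I) + Complex.exp (s * Complex.I)) = 0 := by
      linear_combination -hul - hwl
    exact eq_neg_of_add_eq_zero_left ((mul_eq_zero.1 this).resolve_left hlC)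
  -- the lengths of the two other sides of the triangle with side `uw` and angles `β`, `α`
  have hratio : ∀ α β : ℝ, |α| < π / 3 → |β| < π / 3 → 0 < α * β →
      sin (α + β) ≠ 0 ∧ 0 < sin α / sin (α + β) ∧ sin α / sin (α + β) < 1 := by
    have hpos : ∀ α β : ℝ, 0 < α → 0 < β → α < π / 3 → β < π / 3 →
        0 < sin α ∧ sin α < sin (α + β) := by
      intro α β h1 h2 h3 h4
      refine ⟨sin_pos_of_pos_of_lt_pi h1 (by linarith), ?_⟩
      have h5 : sin (α + β) - sin α = 2 * sin (β / 2) * cos (α + β / 2) := by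
        rw [sin_sub_sin]; ring_nf
      have h6 : 0 < sin (β / 2) := sin_pos_of_pos_of_lt_pi (by linarith) (by linarith)
      -- Here the bound `π / 3` enters: the third angle of the triangle exceeds it, so the base is
      -- the longest side.
      have h7 : 0 < cos (α + β / 2) := cos_pos_of_mem_Ioo ⟨by linarith, by linarith⟩
      nlinarith [mul_pos h6 h7]
    intro α β hα hβ hαβ
    rw [abs_lt] at hα hβ
    rcases mul_pos_iff.1 hαβ with ⟨h1, h2⟩ | ⟨h1, h2⟩
    · obtain ⟨h3, h4⟩ := hpos α β h1 h2 hα.2 hβ.2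
      have h5 := h3.trans h4
      exact ⟨h5.ne', div_pos h3 h5, (div_lt_one h5).2 h4⟩
    · obtain ⟨h3, h4⟩ := hpos (-α) (-β) (by linarith) (by linarith) (by linarith) (by linarith)
      rw [← neg_add, sin_neg, sin_neg] at h4
      rw [sin_neg] at h3
      have h5 : sin (α + β) < 0 := by linarith
      refine ⟨h5.ne, div_pos_of_neg_of_neg (by linarith) h5, ?_⟩
      rw [div_lt_one_of_neg h5]; linarith
  obtain ⟨hs, ha, ha'⟩ := hratio α β hα hβ hαβ
  obtain ⟨-, hb, hb'⟩ := hratio β α hβ hα (by linarith)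
  rw [add_comm β α] at hb hb'
  set A := sin α / sin (α + β) with hA
  set B := sin β / sin (α + β) with hB
  have hseg : ∀ (z : ℂ) (c p x : ℝ), 0 < c → c < 1 → l ≤ p →
      z + (c * l : ℝ) * Complex.exp (x * Complex.I) ∈
        segment ℝ z (z + p * Complex.exp (x * Complex.I)) := by
    intro z c p x h0 h1 h2
    have hp : 0 < p := hl.trans_le h2
    rw [segment_eq_image']
    refine ⟨c * l / p, ⟨by positivity, (div_le_one hp).2 (by nlinarith)⟩, ?_⟩
    have hpC : (p : ℂ) ≠ 0 := by exact_mod_cast hp.ne'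
    simp only [add_sub_cancel_left, Complex.real_smul]
    push_cast
    field_simp
  have hmeet : (A : ℂ) * Complex.exp ((s + β : ℝ) * Complex.I) =
      Complex.exp (s * Complex.I) + B * Complex.exp ((t - α : ℝ) * Complex.I) := by
    have e1 : Complex.exp ((s + β : ℝ) * Complex.I) =
        Complex.exp (s * Complex.I) * (cos β + sin β * Complex.I) := by
      push_cast
      rw [add_mul, Complex.exp_add, Complex.exp_mul_I (β : ℂ)]
    have e2 : Complex.exp ((t - α : ℝ) * Complex.I) =
        -Complex.exp (s * Complex.I) * (cos α - sin α * Complex.I) := by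
      rw [← hexp]
      push_cast
      rw [sub_eq_add_neg, add_mul, Complex.exp_add, Complex.exp_mul_I (-α : ℂ), Complex.cos_neg,
        Complex.sin_neg]
      ring
    -- `r1` compares projections onto `uw`, `r2` heights above it, in units of `l`.
    have r1 : A * cos β + B * cos α = 1 := by
      rw [hA, hB, div_mul_eq_mul_div, div_mul_eq_mul_div, ← add_div, div_eq_one_iff_eq hs,
        sin_add]
      ring
    have r2 : A * sin β = B * sin α := by rw [hA, hB]; ring
    have c1 : (A : ℂ) * cos β + B * cos α = 1 := by exact_mod_cast r1
    have c2 : (A : ℂ) * sin β = B * sin α := by exact_mod_cast r2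
    rw [e1, e2]
    linear_combination Complex.exp (s * Complex.I) * c1 +
      Complex.exp (s * Complex.I) * Complex.I * c2
  refine ⟨u + (A * l : ℝ) * Complex.exp ((s + β : ℝ) * Complex.I),
    ⟨hseg _ _ _ _ ha ha' huy, ?_⟩, ?_, ?_⟩
  · have : u + (A * l : ℝ) * Complex.exp ((s + β : ℝ) * Complex.I) =
        w + (B * l : ℝ) * Complex.exp ((t - α : ℝ) * Complex.I) := by
      rw [hwl]
      push_cast at hmeet ⊢
      linear_combination (l : ℂ) * hmeet
    rw [this]
    exact hseg _ _ _ _ hb hb' hwx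
  · intro h
    have := hd u (A * l) (s + β) (by positivity)
    rw [h, dist_self] at this
    nlinarith [mul_pos ha hl]
  · intro h
    have := hd u (A * l) (s + β) (by positivity)
    rw [h, hd _ _ _ hr] at this
    nlinarith

end Geometry

/-! ### Minimum spanning trees lie in every Delaunay triangulation. -/

section Delaunay

variable {V : Finset ℂ} {G : SimpleGraph V} {u v : V}

/-- The difference of the powers of a point with respect to a circle centred at `c` and to the
circle with diameter `uv`, along a segment. -/
theorem power_sub_power_combo (c u v a b : ℂ) (r s t : ℝ) (hst : s + t = 1) :
    (‖s • a + t • b - c‖ ^ 2 - r - ((s • a + t • b - u) * (starRingEnd ℂ) (s • a + t • b - v)).re) =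
      s * (‖a - c‖ ^ 2 - r - ((a - u) * (starRingEnd ℂ) (a - v)).re) +
      t * (‖b - c‖ ^ 2 - r - ((b - u) * (starRingEnd ℂ) (b - v)).re) := by
  -- The quadratic terms cancel, so the difference is affine in the point.
  obtain rfl : s = 1 - t := by linarith
  simp only [Complex.sq_norm, Complex.normSq_apply, Complex.mul_re, Complex.conj_re,
    Complex.conj_im, Complex.sub_re, Complex.sub_im, Complex.add_re, Complex.add_im,
    Complex.smul_re, Complex.smul_im, smul_eq_mul]
  ring

/-- A point that sees `uv` at an angle of at least `π / 2` is nearer to `u` and `v` than these are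
to each other. -/
theorem dist_lt_of_re_nonpos {u v w : ℂ} (hu : w ≠ u)
    (h : ((w - u) * (starRingEnd ℂ) (w - v)).re ≤ 0) : dist v w < dist u v := by
  have h1 : 0 < ‖w - u‖ ^ 2 := by have := norm_pos_iff.2 (sub_ne_zero.2 hu); positivity
  rw [dist_comm v w, Complex.dist_eq, Complex.dist_eq]
  refine lt_of_pow_lt_pow_left₀ 2 (norm_nonneg _) ?_
  simp only [Complex.sq_norm, Complex.normSq_apply, Complex.mul_re, Complex.conj_re,
    Complex.conj_im, Complex.sub_re, Complex.sub_im] at *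
  nlinarith

/-- An edge whose closed diametral disk contains no other point belongs to every Delaunay
triangulation. -/
theorem IsDelaunayTriangulation.adj_of_gabriel (hG : IsDelaunayTriangulation G) (huv : u ≠ v)
    (hgab : ∀ w : V, w ≠ u → w ≠ v →
      0 < (((w : ℂ) - u) * (starRingEnd ℂ) ((w : ℂ) - v)).re) : G.Adj u v := by
  have hends : ∀ w : V, 0 ≤ (((w : ℂ) - u) * (starRingEnd ℂ) ((w : ℂ) - v)).re := by
    intro w
    by_cases h1 : w = u
    · simp [h1]
    by_cases h2 : w = v
    · simp [h2]
    exact (hgab w h1 h2).le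
  have hseg : ∀ p ∈ segment ℝ (u : ℂ) v, ((p - u) * (starRingEnd ℂ) (p - v)).re ≤ 0 := by
    rintro p ⟨s, t, hs, ht, hst, rfl⟩
    obtain rfl : s = 1 - t := by linarith
    have h : (((1 - t) • (u : ℂ) + t • (v : ℂ) - u) *
        (starRingEnd ℂ) ((1 - t) • (u : ℂ) + t • (v : ℂ) - v)).re =
        -((1 - t) * t * ‖(u : ℂ) - v‖ ^ 2) := by
      simp only [Complex.sq_norm, Complex.normSq_apply, Complex.mul_re, Complex.conj_re,
        Complex.conj_im, Complex.sub_re, Complex.sub_im, Complex.add_re, Complex.add_im,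
        Complex.smul_re, Complex.smul_im, smul_eq_mul]
      ring
    rw [h]
    have : 0 ≤ (1 - t) * t * ‖(u : ℂ) - v‖ ^ 2 := by positivity
    linarith
  have hcross : ∀ a b : V, G.Adj a b → s(a, b) ≠ s(u, v) →
      segment ℝ (a : ℂ) b ∩ segment ℝ (u : ℂ) v ⊆ {(a : ℂ), (b : ℂ)} ∩ {(u : ℂ), (v : ℂ)} := by
    rintro a b hab hne p ⟨hp, hp'⟩
    obtain ⟨c, hc, hempty⟩ := hG.empty_circle a b hab
    have key := power_sub_power_combo c u v
    -- `f` is nonnegative at `u`, `v`, which are not inside the empty circle of `ab`, and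
    -- nonpositive at `a`, `b`, strictly so off `{u, v}`. Being affine, it allows a common point of
    -- the segments only at a shared endpoint.
    set f : ℂ → ℝ := fun z =>
      ‖z - c‖ ^ 2 - dist c a ^ 2 - ((z - u) * (starRingEnd ℂ) (z - v)).re with hf
    have hfa : f a = -(((a : ℂ) - u) * (starRingEnd ℂ) ((a : ℂ) - v)).re := by
      simp only [hf, dist_comm c (a : ℂ), Complex.dist_eq]; ring
    have hfb : f b = -(((b : ℂ) - u) * (starRingEnd ℂ) ((b : ℂ) - v)).re := by
      simp only [hf, hc, dist_comm c (b : ℂ), Complex.dist_eq]; ring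
    have hfu : 0 ≤ f u := by
      have := pow_le_pow_left₀ dist_nonneg (hempty u) 2
      rw [dist_comm c (u : ℂ), Complex.dist_eq (u : ℂ)] at this
      simpa [hf] using this
    have hfv : 0 ≤ f v := by
      have := pow_le_pow_left₀ dist_nonneg (hempty v) 2
      rw [dist_comm c (v : ℂ), Complex.dist_eq (v : ℂ)] at this
      simpa [hf] using this
    have hfp : 0 ≤ f p := by
      obtain ⟨s, t, hs, ht, hst, rfl⟩ := hp'
      rw [show f _ = _ from key u v _ s t hst]
      exact add_nonneg (mul_nonneg hs hfu) (mul_nonneg ht hfv)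
    obtain ⟨s, t, hs, ht, hst, rfl⟩ := hp
    rw [show f _ = s * f a + t * f b from key a b _ s t hst] at hfp
    have hab0 : a ≠ b := hab.ne
    have ha : (a = u ∨ a = v) ∨ f a < 0 := by
      by_cases h : a = u ∨ a = v
      · exact Or.inl h
      · push Not at h
        exact Or.inr (by linarith [hgab a h.1 h.2])
    have hb : (b = u ∨ b = v) ∨ f b < 0 := by
      by_cases h : b = u ∨ b = v
      · exact Or.inl h
      · push Not at h
        exact Or.inr (by linarith [hgab b h.1 h.2])
    have hfa0 : f a ≤ 0 := by linarith [hends a]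
    have hfb0 : f b ≤ 0 := by linarith [hends b]
    rcases ha with ha | ha <;> rcases hb with hb | hb
    · exfalso
      rcases ha with rfl | rfl <;> rcases hb with rfl | rfl <;> simp_all [Sym2.eq_swap]
    · have ht0 : t = 0 := by nlinarith
      obtain rfl : s = 1 := by linarith
      subst ht0
      rcases ha with rfl | rfl <;> simp
    · have hs0 : s = 0 := by nlinarith
      obtain rfl : t = 1 := by linarith
      subst hs0
      rcases hb with rfl | rfl <;> simp
    · exfalso
      rcases hs.eq_or_lt with rfl | hs
      · obtain rfl : t = 1 := by linarith
        linarith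
      · nlinarith
  have hplane : IsPlane (G ⊔ SimpleGraph.edge u v) := by
    refine ⟨?_, ?_⟩
    · rintro a b w (hab | hab) hw
      · exact hG.maximal_plane.prop.1 a b w hab hw
      · have huvw : (w : ℂ) ∈ segment ℝ (u : ℂ) v → w = u ∨ w = v := by
          intro hw
          by_contra! h
          exact absurd (hseg w hw) (not_le.2 (hgab w h.1 h.2))
        rcases ((SimpleGraph.edge_adj ..).1 hab).1 with ⟨rfl, rfl⟩ | ⟨rfl, rfl⟩
        · exact huvw hw
        · rw [segment_symm] at hw
          exact (huvw hw).symm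
    · have hedge : ∀ {c d : V}, (SimpleGraph.edge u v).Adj c d →
          s(c, d) = s(u, v) ∧ segment ℝ (c : ℂ) d = segment ℝ (u : ℂ) v ∧
            ({(c : ℂ), (d : ℂ)} : Set ℂ) = {(u : ℂ), (v : ℂ)} := by
        intro c d hcd
        rcases ((SimpleGraph.edge_adj ..).1 hcd).1 with ⟨rfl, rfl⟩ | ⟨rfl, rfl⟩
        · exact ⟨rfl, rfl, rfl⟩
        · exact ⟨Sym2.eq_swap, segment_symm .., Set.pair_comm ..⟩
      rintro a b c d (hab | hab) (hcd | hcd) hne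
      · exact hG.maximal_plane.prop.2 a b c d hab hcd hne
      · obtain ⟨h1, h2, h3⟩ := hedge hcd
        rw [h2, h3]
        exact hcross a b hab (h1 ▸ hne)
      · obtain ⟨h1, h2, h3⟩ := hedge hab
        rw [h2, h3, Set.inter_comm, Set.inter_comm {(u : ℂ), (v : ℂ)}]
        exact hcross c d hcd (h1 ▸ hne.symm)
      · exact absurd ((hedge hab).1.trans (hedge hcd).1.symm) hne
  exact hG.maximal_plane.le_of_ge hplane le_sup_left
    (Or.inr ((SimpleGraph.edge_adj ..).2 ⟨Or.inl ⟨rfl, rfl⟩, huv⟩))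

/-- A Delaunay triangulation contains every minimum spanning tree. -/
theorem IsMinimumSpanningTree.le_of_isDelaunayTriangulation {T : SimpleGraph V}
    (hT : IsMinimumSpanningTree T) (hG : IsDelaunayTriangulation G) : T ≤ G := by
  intro u v huv
  refine hG.adj_of_gabriel huv.ne fun w hwu hwv => ?_
  by_contra! h
  have h1 : dist (v : ℂ) w < dist (u : ℂ) v :=
    dist_lt_of_re_nonpos (fun h => hwu (Subtype.ext h)) h
  have h2 : dist (u : ℂ) w < dist (v : ℂ) u := by
    refine dist_lt_of_re_nonpos (fun h => hwv (Subtype.ext h)) ?_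
    simp only [Complex.mul_re, Complex.conj_re, Complex.conj_im] at h ⊢
    linarith
  linarith [hT.le_of_lt huv h1, dist_comm (u : ℂ) v]

end Delaunay

/-! ### Protected edges. -/

section MBDG

variable {V : Finset ℂ} {θ : ℝ} {DT : SimpleGraph V} {C : (u : V) → ConePartition θ (u : ℂ)}
  {mid : V → Fin (coneCount θ) → V} {T : SimpleGraph V} {u v w : V}
  {i j : Fin (coneCount θ)}

/-- `AngleLE` is existential in the angles, so its negation is strict for any angles chosen, and one
angle of `v` serves both sides. -/
theorem exists_onRay_of_notMem_angularEnds {A : Set ℝ} {S : Set V} (hSA : ∀ x ∈ S,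
    (x : ℂ) ∈ sector (u : ℂ) A) (hv : v ∈ S) (hvS : v ∉ angularEnds u A S) :
    ∃ t ∈ A, OnRay (u : ℂ) t v ∧ (∃ x ∈ S, ∃ s ∈ A, OnRay (u : ℂ) s x ∧ s < t) ∧
      ∃ x ∈ S, ∃ s ∈ A, OnRay (u : ℂ) s x ∧ t < s := by
  simp only [angularEnds, Set.mem_ofPred_eq, hv, true_and, not_or, not_forall] at hvS
  obtain ⟨⟨x, hx, hxv⟩, y, hy, hyv⟩ := hvS
  obtain ⟨t, ht, hvt⟩ := hSA v hv
  obtain ⟨s, hs, hxs⟩ := hSA x hx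
  obtain ⟨r, hr, hyr⟩ := hSA y hy
  refine ⟨t, ht, hvt, ⟨x, hx, s, hs, hxs, ?_⟩, y, hy, r, hr, hyr, ?_⟩
  · by_contra! h
    exact hxv ⟨t, ht, s, hs, hvt, hxs, h⟩
  · by_contra! h
    exact hyv ⟨r, hr, t, ht, hyr, hvt, h⟩

theorem ConePartition.abs_sub_le {z : ℂ} (P : ConePartition θ z) {k : Fin (coneCount θ)} {s t : ℝ}
    (hs : s ∈ P.arc k) (ht : t ∈ P.arc k) : |s - t| ≤ θ :=
  abs_sub_le_iff.2 ⟨P.width_le k t ht s hs, P.width_le k s hs t ht⟩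

/-- An edge of a minimum spanning tree is shortest in its cone. -/
theorem IsMinimumSpanningTree.dist_le_of_sector (hT : IsMinimumSpanningTree T) (hθ : θ < π / 3)
    (huv : T.Adj u v) (hv : (v : ℂ) ∈ sector (u : ℂ) ((C u).arc i))
    (hw : (w : ℂ) ∈ sector (u : ℂ) ((C u).arc i)) : dist (u : ℂ) v ≤ dist (u : ℂ) w := by
  obtain ⟨s, hs, hvs⟩ := hv
  obtain ⟨t, ht, hwt⟩ := hw
  by_contra! h
  exact h.not_ge (hT.le_of_lt huv
    (dist_lt_of_onRay hvs hwt (((C u).abs_sub_le hs ht).trans_lt hθ) h.le))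

/-- An edge of a minimum spanning tree is extreme at one of its ends. -/
theorem IsMinimumSpanningTree.mem_extremeAt_or (hT : IsMinimumSpanningTree T) (hθ : θ < π / 3)
    (hDT : IsDelaunayTriangulation DT) (huw : T.Adj u w) (hw : w ∈ coneNeighbors DT C u i)
    (hu : u ∈ coneNeighbors DT C w j) :
    w ∈ extremeAt DT C u i ∨ u ∈ extremeAt DT C w j := by
  by_contra! h
  -- `y` comes after `w` around `u`, and `x` before `u` around `w`: this puts both on the same side
  -- of `uw`.
  obtain ⟨s, hs, hws, -, y, hy, s', hs', hys, hss⟩ :=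
    exists_onRay_of_notMem_angularEnds (fun x hx => hx.2) hw h.1
  obtain ⟨t, ht, hut, ⟨x, hx, t', ht', hxt, htt⟩, -⟩ :=
    exists_onRay_of_notMem_angularEnds (fun x hx => hx.2) hu h.2
  obtain ⟨p, hp, hpu, hpy⟩ := exists_crossing (α := t - t') (β := s' - s) hws
    (by rwa [add_sub_cancel]) hut (by rwa [sub_sub_cancel])
    (((C w).abs_sub_le ht ht').trans_lt hθ) (((C u).abs_sub_le hs' hs).trans_lt hθ)
    (mul_pos (sub_pos.2 htt) (sub_pos.2 hss)) (hT.dist_le_of_sector hθ huw hw.2 hy.2)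
    (by rw [dist_comm]; exact hT.dist_le_of_sector hθ huw.symm hu.2 hx.2)
  have hne : s(u, y) ≠ s(w, x) := by
    intro he
    rcases Sym2.eq_iff.1 he with ⟨h1, -⟩ | ⟨rfl, rfl⟩
    · exact huw.ne h1
    have hβ := abs_lt.1 (((C u).abs_sub_le hs' hs).trans_lt hθ)
    exact hss.ne (hws.angle_eq hys (abs_lt.2 ⟨by linarith [pi_pos], by linarith [pi_pos]⟩))
  have := hDT.maximal_plane.prop.2 u y w x hy.1 hx.1 hne hp
  rcases this.1 with h | h
  · exact hpu h
  · exact hpy h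

theorem exists_mem_coneNeighbors (C : (u : V) → ConePartition θ (u : ℂ)) (huv : DT.Adj u v) :
    ∃ i, v ∈ coneNeighbors DT C u i := by
  obtain ⟨i, hi, -⟩ := (C u).partition v fun h => huv.ne (Subtype.ext h.symm)
  exact ⟨i, huv, hi⟩

/-- An edge of a minimum spanning tree that is not protected at `u` can be exchanged for an edge of
the bounded degree graph. -/
theorem IsMinimumSpanningTree.exists_exchange_mem_MBDG (hT : IsMinimumSpanningTree T)
    (hθ : θ < π / 3) (hDT : IsDelaunayTriangulation DT) (hmid : IsMiddleChoice DT C mid)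
    (huv : T.Adj u v) (hprot : ¬ ProtectedAt DT C mid u v) :
    ∃ w, (MBDG DT C mid).Adj u w ∧
      IsMinimumSpanningTree (T.deleteEdges {s(u, v)} ⊔ SimpleGraph.edge u w) := by
  have hle := hT.le_of_isDelaunayTriangulation hDT
  obtain ⟨i, hi⟩ := exists_mem_coneNeighbors C (hle huv)
  simp only [ProtectedAt, not_exists, not_or, not_and] at hprot
  obtain ⟨hext, hpen, -⟩ := hprot i
  have hrem : v ∈ remainingAt DT C u i := ⟨⟨hi, hext⟩, hpen⟩
  obtain ⟨hw, hmin⟩ := hmid u i ⟨v, hrem⟩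
  have hwi := hw.1.1
  have hex : dist (v : ℂ) (mid u i : ℂ) < dist (u : ℂ) v := by
    obtain ⟨s, hs, hvs⟩ := hi.2
    obtain ⟨t, ht, hwt⟩ := hwi.2
    exact dist_lt_of_onRay hvs hwt (((C u).abs_sub_le hs ht).trans_lt hθ) (hmin v hrem)
  have hT' := (hT.exchange huv hex (hmin v hrem)).1
  have huw : (T.deleteEdges {s(u, v)} ⊔ SimpleGraph.edge u (mid u i)).Adj u (mid u i) :=
    Or.inr ((SimpleGraph.edge_adj ..).2 ⟨Or.inl ⟨rfl, rfl⟩, hwi.1.ne⟩)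
  obtain ⟨j, hj⟩ := exists_mem_coneNeighbors C hwi.1.symm
  -- Applied to the new tree, since `uw` need not be an edge of `T`.
  have hj' := (hT'.mem_extremeAt_or hθ hDT huw hwi hj).resolve_left hw.1.2
  exact ⟨mid u i, ⟨hwi.1, ⟨i, Or.inr (Or.inr ⟨hw, rfl⟩)⟩, j, Or.inl hj'⟩, hT'⟩

end MBDG

theorem mainTheorem10 (V : Finset ℂ) (hV : V.Nonempty) (θ : ℝ) (hθ_pos : 0 < θ)
    (hθ : θ < π / 3) (DT : SimpleGraph V) (hDT : IsDelaunayTriangulation DT)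
    (C : (u : V) → ConePartition θ (u : ℂ)) (mid : V → Fin (coneCount θ) → V)
    (hmid : IsMiddleChoice DT C mid) :
    ∃ T : SimpleGraph V, IsMinimumSpanningTree T ∧ T ≤ MBDG DT C mid := by
  obtain ⟨T, hT, hmin⟩ := Set.exists_min_image {T : SimpleGraph V | IsMinimumSpanningTree T}
    (fun T => (T.edgeSet \ (MBDG DT C mid).edgeSet).ncard) (Set.toFinite _)
    (exists_isMinimumSpanningTree hV)
  have hprot : ∀ u v, T.Adj u v → ProtectedAt DT C mid u v := by
    intro u v huv
    by_contra hp
    obtain ⟨w, huw, hT'⟩ := hT.exists_exchange_mem_MBDG hθ hDT hmid huv hp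
    -- The exchange removes the bad edge `uv` and adds only a good one.
    refine (hmin _ hT').not_gt (Set.ncard_lt_ncard ?_ (Set.toFinite _))
    refine Set.ssubset_iff_of_subset ?_ |>.2 ⟨s(u, v), ⟨huv, fun h => hp h.2.1⟩, ?_⟩
    · intro e
      induction e with
      | _ x y =>
        rintro ⟨h | h, hxy⟩
        · exact ⟨SimpleGraph.deleteEdges_le _ h, hxy⟩
        · have he := (SimpleGraph.adj_edge ..).1 h
          exact absurd (he.1 ▸ huw : s(x, y) ∈ (MBDG DT C mid).edgeSet) hxy
    · rintro ⟨h | h, h'⟩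
      · exact (SimpleGraph.deleteEdges_adj.1 h).2 rfl
      · exact h' (((SimpleGraph.adj_edge ..).1 h).1 ▸ huw)
  exact ⟨T, hT, fun u v huv => ⟨hT.le_of_isDelaunayTriangulation hDT huv, hprot u v huv,
    hprot v u huv.symm⟩⟩
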